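/- All semirings are commutative with $0$ and $1$, and semiring homomorphisms preserve $+,\cdot,0,1$. Let $\mathbb B=\{0,-\infty\}$ be the Boolean semifield, with addition $\max$ and multiplication $+$. For a positive integer $n$, let $\mathbb B[x_1^{\pm},\dots,x_n^{\pm}]_{\mathrm{fcn}}$ be the quotient of the Laurent polynomial semiring $\mathbb B[x_1^{\pm},\dots,x_n^{\pm}]$ by the congruence identifying two polynomials that define the same function on $\mathbb R^n$; here $\bigoplus_i x^{u_i}$ (with $u_i\in\mathbb Z^n$) defines the function $p\mapsto\max_i (u_i\cdot p)$, and the zero polynomial defines the constant $-\infty$. For a finite set $A$, let $\mathbb Z^A_{\mathrm{pos}}\cup\{-\infty\}$ be the semiring of maps $F:A\to\mathbb Z\cup\{-\infty\}$ such that $\sum_{a\in A}F(a)\ge 0$ or $F\equiv-\infty$, with pointwise $\max$ as addition and pointwise $+$ as multiplication. A $1$-dimensional tropical fan $X$ in $\mathbb R^n$ consists of the cone $\{0\}$ and a nonempty finite set $X(1)$ of rays, each spanned by a nonzero integer vector, with a positive integer weight $w_\rho$ for each $\rho\in X(1)$, satisfying the balancing condition $\sum_{\rho\in X(1)}w_\rho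 d_\rho=0$, where $d_\rho\in\mathbb Z^n$ is the primitive direction vector of $\rho$. Its support $|X|$ is the union of its rays. Its weighted evaluation map is the semiring homomorphism $$\varphi_X:\mathbb B[x_1^{\pm},\dots,x_n^{\pm}]_{\mathrm{fcn}}\to\mathbb Z^{X(1)}_{\mathrm{pos}}\cup\{-\infty\},\qquad \varphi_X(f)(\rho)=w_\rho f(d_\rho).$$ One has $\varphi_X(f)=\varphi_X(g)$ if and only if $f|_{|X|}=g|_{|X|}$. Let $\mathcal C$ be the category whose objects are the $1$-dimensional tropical fans in $\mathbb R^n$ for some positive integer $n$; a morphism from $X$ (in $\mathbb R^n$) to $Y$ (in $\mathbb R^m$) is a map $|X|\to|Y|$ that is the restriction of a linear map $\mathbb R^n\to\mathbb R^m$ given by an integer matrix. Let $\mathcal D$ be the category whose objects are the semiring homomorphisms $\varphi:\mathbb B[x_1^{\pm},\dots,x_n^{\pm}]_{\mathrm{fcn}}\to\mathbb Z^A_{\mathrm{pos}}\cup\{-\infty\}$ for some positive integer $n$ and some finite set $A$; a morphism $\varphi\to\psi$ is a semiring homomorphism $\operatorname{Im}(\varphi)\to\operatorname{Im}(\psi)$.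 Let $\Phi:\mathcal C^{\mathrm{op}}\to\mathcal D$ be the contravariant functor that sends $X$ to $\varphi_X$ and a morphism $\mu:X\to Y$ to the homomorphism $\Phi(\mu):\operatorname{Im}(\varphi_Y)\to\operatorname{Im}(\varphi_X)$ with $\Phi(\mu)(\varphi_Y(f))=\varphi_X(g)$ whenever $g|_{|X|}=f\circ\mu$. Then $\Phi$ is fully faithful: for all $1$-dimensional tropical fans $X,Y$, the map $\mu\mapsto\Phi(\mu)$ from the set of morphisms $X\to Y$ to the set of semiring homomorphisms $\operatorname{Im}(\varphi_Y)\to\operatorname{Im}(\varphi_X)$ is bijective. -/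

import Mathlib

open CategoryTheory

noncomputable section

namespace TropicalFans

/-! ### Max-plus semirings -/

/-- The set `M ∪ {-∞}`, to be endowed with the addition `max` and the multiplication `+`. -/
def MaxPlus (M : Type*) : Type _ := WithBot M

namespace MaxPlus

variable {M N : Type*}

instance [LinearOrder M] : LinearOrder (MaxPlus M) := inferInstanceAs (LinearOrder (WithBot M))

/-- The inclusion of `M` into `M ∪ {-∞}`. -/
def of (x : M) : MaxPlus M := ((x : WithBot M) : WithBot M)

instance [LinearOrder M] : Add (MaxPlus M) := ⟨fun x y => max (α := WithBot M) x y⟩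

instance : Zero (MaxPlus M) := ⟨(⊥ : WithBot M)⟩

/-- The semiring structure on `M ∪ {-∞}`: the sum is `max`, the product is the addition of `M`
(with `-∞` absorbing), the zero is `-∞` and the one is the element `0` of `M`. -/
instance [AddCommMonoid M] [LinearOrder M] [IsOrderedAddMonoid M] : CommSemiring (MaxPlus M) where
  mul x y := (HAdd.hAdd : WithBot M → WithBot M → WithBot M) x y
  one := of 0
  add_assoc x y z := max_assoc (α := WithBot M) x y z
  zero_add x := max_eq_right (bot_le (α := WithBot M) (a := x))
  add_zero x := max_eq_left (bot_le (α := WithBot M) (a := x))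
  add_comm x y := max_comm (α := WithBot M) x y
  mul_assoc x y z := add_assoc (G := WithBot M) x y z
  one_mul x := zero_add (M := WithBot M) x
  mul_one x := add_zero (M := WithBot M) x
  mul_comm x y := add_comm (G := WithBot M) x y
  zero_mul x := WithBot.bot_add (α := M) x
  mul_zero x := WithBot.add_bot (α := M) x
  left_distrib x y z :=
    (Monotone.map_max (α := WithBot M) (β := WithBot M)
      (f := fun t => (HAdd.hAdd : WithBot M → WithBot M → WithBot M) x t)
      (fun _ _ h => add_le_add_right h x))
  right_distrib x y z :=
    (Monotone.map_max (α := WithBot M) (β := WithBot M)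
      (f := fun t => (HAdd.hAdd : WithBot M → WithBot M → WithBot M) t z)
      (fun _ _ h => add_le_add_left h z))
  nsmul := nsmulRec

section

variable [AddCommMonoid M] [LinearOrder M] [IsOrderedAddMonoid M]
variable [AddCommMonoid N] [LinearOrder N] [IsOrderedAddMonoid N]

theorem add_eq_max (x y : MaxPlus M) : x + y = max x y := rfl

theorem of_add (x y : M) : of (x + y) = of x * of y := rfl

theorem of_zero : of (0 : M) = 1 := rfl

theorem prod_of {ι : Type*} (s : Finset ι) (f : ι → M) :
    ∏ i ∈ s, of (f i) = of (∑ i ∈ s, f i) := by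
  classical
  induction s using Finset.induction_on with
  | empty => rfl
  | insert a s ha ih => rw [Finset.prod_insert ha, Finset.sum_insert ha, ih, of_add]

theorem mul_le_mul_mp {a b c d : MaxPlus M} (h : a ≤ b) (h' : c ≤ d) : a * c ≤ b * d :=
  add_le_add (α := WithBot M) h h'

theorem prod_le_prod_mp {ι : Type*} (s : Finset ι) {f g : ι → MaxPlus M}
    (h : ∀ i ∈ s, f i ≤ g i) : ∏ i ∈ s, f i ≤ ∏ i ∈ s, g i := by
  classical
  induction s using Finset.induction_on with
  | empty => exact le_refl _
  | insert a s ha ih =>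
    rw [Finset.prod_insert ha, Finset.prod_insert ha]
    exact mul_le_mul_mp (h a (Finset.mem_insert_self a s))
      (ih fun i hi => h i (Finset.mem_insert_of_mem hi))

/-- The semiring homomorphism `M ∪ {-∞} → N ∪ {-∞}` induced by a monotone additive map `M → N`,
sending `-∞` to `-∞`. -/
def map (h : M →+o N) : MaxPlus M →+* MaxPlus N where
  toFun x := WithBot.map (α := M) (β := N) h x
  map_one' := congrArg of (map_zero h)
  map_mul' x y := by
    induction x using WithBot.recBotCoe with
    | bot => exact (congrArg (WithBot.map h) (WithBot.bot_add _)).trans (WithBot.bot_add _).symm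
    | coe x =>
      induction y using WithBot.recBotCoe with
      | bot => exact (congrArg (WithBot.map h) (WithBot.add_bot _)).trans (WithBot.add_bot _).symm
      | coe y => exact congrArg of (map_add h x y)
  map_zero' := rfl
  map_add' x y :=
    Monotone.map_max (α := WithBot M) (β := WithBot N) (f := WithBot.map h)
      (WithBot.monotone_map_iff.2 h.monotone')

theorem map_of (h : M →+o N) (x : M) : map h (of x) = of (h x) := rfl

theorem map_injective (h : M →+o N) (hh : Function.Injective h) : Function.Injective (map h) :=
  Option.map_injective hh

end

end MaxPlus

/-- The tropical semifield `ℝ ∪ {-∞}`. -/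
abbrev 𝕋 : Type := MaxPlus ℝ

/-- The Boolean semifield `{-∞, 0}`, realized as `{0} ∪ {-∞}`. -/
abbrev 𝔹 : Type := MaxPlus Unit

/-! ### Boolean Laurent polynomials and Boolean Laurent polynomial functions -/

/-- The Boolean Laurent polynomial semiring `𝔹[x₁^±, …, x_n^±]`. -/
abbrev LaurentPoly (n : ℕ) : Type := AddMonoidAlgebra 𝔹 (Fin n → ℤ)

section Eval

variable {M N : Type*} [AddCommGroup M] [LinearOrder M] [IsOrderedAddMonoid M]
  [AddCommGroup N] [LinearOrder N] [IsOrderedAddMonoid N]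

/-- The value `u ↦ u₁ p₁ + ⋯ + u_n p_n` at the point `p` of the monomial `x^u`. -/
def monomialEval {n : ℕ} (p : Fin n → M) : Multiplicative (Fin n → ℤ) →* MaxPlus M where
  toFun u := MaxPlus.of (∑ i, u.toAdd i • p i)
  map_one' := by
    rw [← MaxPlus.of_zero]
    simp
  map_mul' u v := by
    rw [← MaxPlus.of_add, ← Finset.sum_add_distrib]
    simp [add_smul]

/-- Evaluation of Boolean Laurent polynomials at a point `p`:
`⨁ᵢ x^{uᵢ} ↦ maxᵢ (uᵢ · p)`, and the zero polynomial goes to `-∞`. -/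
def polyEval {n : ℕ} (p : Fin n → M) : LaurentPoly n →+* MaxPlus M :=
  AddMonoidAlgebra.liftNCRingHom (MaxPlus.map (0 : Unit →+o M)) (monomialEval p)
    fun _ _ => Commute.all _ _

theorem polyEval_single {n : ℕ} (p : Fin n → M) (u : Fin n → ℤ) :
    polyEval p (AddMonoidAlgebra.single u 1) = MaxPlus.of (∑ i, u i • p i) := by
  simp [polyEval, monomialEval]

theorem bool_eq (b : 𝔹) : b = 0 ∨ b = 1 := by
  induction b using WithBot.recBotCoe with
  | bot => exact Or.inl rfl
  | coe x => exact Or.inr rfl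

theorem poly_hom_ext {n : ℕ} {R : Type*} [CommSemiring R] {f g : LaurentPoly n →+* R}
    (h : ∀ u, f (AddMonoidAlgebra.single u 1) = g (AddMonoidAlgebra.single u 1)) : f = g := by
  refine AddMonoidAlgebra.ringHom_ext (fun b => ?_) h
  rcases bool_eq b with rfl | rfl
  · simp
  · exact h 0

theorem map_polyEval {n : ℕ} (h : M →+o N) (p : Fin n → M) (P : LaurentPoly n) :
    MaxPlus.map h (polyEval p P) = polyEval (fun i => h (p i)) P := by
  have : (MaxPlus.map h).comp (polyEval p) = polyEval (fun i => h (p i)) := by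
    refine poly_hom_ext fun u => ?_
    rw [RingHom.comp_apply, polyEval_single, polyEval_single, MaxPlus.map_of]
    simp
  exact congrArg (fun f => f P) this

theorem exists_monomial_le {n : ℕ} {P : LaurentPoly n} (hP : P ≠ 0) :
    ∃ u : Fin n → ℤ, ∀ p : Fin n → M, MaxPlus.of (∑ i, u i • p i) ≤ polyEval p P := by
  have : ∃ u, P + AddMonoidAlgebra.single u 1 = P := by
    by_contra! hcon
    apply hP
    ext u
    rcases bool_eq (P.coeff u) with h | h
    · simpa using h
    · exfalso
      apply hcon u
      ext v
      by_cases huv : u = v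
      · subst huv
        simp only [AddMonoidAlgebra.coeff_add, Finsupp.add_apply, h]
        simp
        rfl
      · simp [huv]
  obtain ⟨u, hu⟩ := this
  refine ⟨u, fun p => ?_⟩
  rw [← hu, map_add, polyEval_single, MaxPlus.add_eq_max]
  exact le_max_right _ _

end Eval

/-- The function on `ℝⁿ` defined by a Boolean Laurent polynomial. -/
def polyFunction (n : ℕ) : LaurentPoly n →+* ((Fin n → ℝ) → 𝕋) :=
  RingHom.pi fun p => polyEval p

/-- The Boolean Laurent polynomial function semiring: the quotient of the Boolean Laurent
polynomial semiring by the congruence of all pairs that define the same function on `ℝⁿ`. -/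
abbrev LaurentFcn (n : ℕ) : Type := (RingCon.ker (polyFunction n)).Quotient

/-- The function on `ℝⁿ` given by an element of `LaurentFcn n`. -/
def toFcn (n : ℕ) : LaurentFcn n →+* ((Fin n → ℝ) → 𝕋) := RingCon.kerLift (polyFunction n)

/-- The order embedding `ℤ → ℝ`. -/
def intCast : ℤ →+o ℝ where
  toFun z := z
  map_zero' := Int.cast_zero
  map_add' := Int.cast_add
  monotone' := Int.cast_mono

/-- The embedding `ℤ ∪ {-∞} → ℝ ∪ {-∞}`. -/
def castT : MaxPlus ℤ →+* 𝕋 := MaxPlus.map intCast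

theorem castT_injective : Function.Injective castT :=
  MaxPlus.map_injective _ Int.cast_injective

/-- The value in `ℤ ∪ {-∞}` of a Boolean Laurent polynomial function at an integer vector. -/
def intEval {n : ℕ} (d : Fin n → ℤ) : LaurentFcn n →+* MaxPlus ℤ :=
  RingCon.lift _ (polyEval d) fun P Q h => castT_injective <| by
    have h' : polyFunction n P = polyFunction n Q := h
    simp only [castT, map_polyEval]
    exact congrFun h' _

theorem castT_intEval {n : ℕ} (d : Fin n → ℤ) (f : LaurentFcn n) :
    castT (intEval d f) = toFcn n f (fun i => (d i : ℝ)) := by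
  obtain ⟨P, rfl⟩ := RingCon.mk'_surjective _ f
  exact map_polyEval intCast d P

/-- Multiplication by a nonnegative real number. -/
def realScale (t : ℝ) (ht : 0 ≤ t) : ℝ →+o ℝ where
  toFun x := t * x
  map_zero' := mul_zero t
  map_add' := mul_add t
  monotone' _ _ h := mul_le_mul_of_nonneg_left h ht

theorem toFcn_smul {n : ℕ} (f : LaurentFcn n) (t : ℝ) (ht : 0 ≤ t) (p : Fin n → ℝ) :
    toFcn n f (t • p) = MaxPlus.map (realScale t ht) (toFcn n f p) := by
  obtain ⟨P, rfl⟩ := RingCon.mk'_surjective _ f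
  exact (map_polyEval (realScale t ht) p P).symm

/-- The congruence `𝐄(Z)_𝔹` of all pairs of Boolean Laurent polynomial functions that agree on
`Z`. -/
def congruenceOf {n : ℕ} (Z : Set (Fin n → ℝ)) : RingCon (LaurentFcn n) :=
  RingCon.ker ((RingHom.pi fun p : Z => Pi.evalRingHom (fun _ : Fin n → ℝ => 𝕋) p).comp (toFcn n))

theorem congruenceOf_iff {n : ℕ} {Z : Set (Fin n → ℝ)} {f g : LaurentFcn n} :
    congruenceOf Z f g ↔ ∀ p ∈ Z, toFcn n f p = toFcn n g p := by
  rw [congruenceOf, RingCon.ker_apply, funext_iff, Subtype.forall]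
  rfl

/-! ### The semiring `ℤ^A_pos ∪ {-∞}` -/

section ZPos

variable {A : Type*} [Fintype A]

/-- The degree of `F : A → ℤ ∪ {-∞}`, that is, the sum of its values (a product in the max-plus
semiring). -/
def deg (F : A → MaxPlus ℤ) : MaxPlus ℤ := ∏ a, F a

variable (A) in
/-- The semiring `ℤ^A_pos ∪ {-∞}` of the maps `A → ℤ ∪ {-∞}` that have nonnegative degree or are
constantly `-∞`, with pointwise operations. -/
def ZPos : Subsemiring (A → MaxPlus ℤ) where
  carrier := {F | MaxPlus.of 0 ≤ deg F} ∪ {0}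
  zero_mem' := Or.inr rfl
  one_mem' := Or.inl (by simp [deg, MaxPlus.of_zero])
  add_mem' := by
    rintro F G (hF | rfl) hG
    · exact Or.inl (le_trans hF
        (MaxPlus.prod_le_prod_mp _ fun a _ => le_max_left (F a) (G a)))
    · simpa using hG
  mul_mem' := by
    rintro F G (hF | rfl) (hG | rfl)
    · refine Or.inl ?_
      have h := MaxPlus.mul_le_mul_mp hF hG
      rw [← MaxPlus.of_add, add_zero] at h
      simpa [deg, Finset.prod_mul_distrib] using h
    · exact Or.inr (mul_zero _)
    · exact Or.inr (zero_mul _)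
    · exact Or.inr (zero_mul _)

end ZPos

/-! ### One-dimensional tropical fans -/

/-- The ray in `ℝⁿ` spanned by an integer vector. -/
def ray {n : ℕ} (d : Fin n → ℤ) : Set (Fin n → ℝ) :=
  {p | ∃ t : ℝ, 0 ≤ t ∧ p = t • fun i => (d i : ℝ)}

/-- A rational ray in `ℝⁿ`: a ray that is spanned by a nonzero integer vector. -/
def IsRationalRay {n : ℕ} (ρ : Set (Fin n → ℝ)) : Prop :=
  ∃ v : Fin n → ℤ, v ≠ 0 ∧ ρ = ray v

theorem IsRationalRay.exists_primitive {n : ℕ} {ρ : Set (Fin n → ℝ)} (h : IsRationalRay ρ) :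
    ∃ d : Fin n → ℤ, Finset.univ.gcd d = 1 ∧ ρ = ray d := by
  obtain ⟨v, hv, rfl⟩ := h
  obtain ⟨j, hj⟩ := Function.ne_iff.1 hv
  obtain ⟨d, hd, hd1⟩ := Finset.extract_gcd v (s := Finset.univ) ⟨j, Finset.mem_univ j⟩
  have hg0 : 0 ≤ Finset.univ.gcd v := Int.nonneg_of_normalize_eq_self Finset.normalize_gcd
  have hg : 0 < Finset.univ.gcd v := by
    refine lt_of_le_of_ne hg0 fun h0 => hj ?_
    exact Finset.gcd_eq_zero_iff.1 h0.symm j (Finset.mem_univ j)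
  refine ⟨d, hd1, ?_⟩
  have hgR : (0 : ℝ) < (Finset.univ.gcd v : ℤ) := by exact_mod_cast hg
  have hvd : (fun i => (v i : ℝ)) = ((Finset.univ.gcd v : ℤ) : ℝ) • fun i => (d i : ℝ) := by
    funext i
    have := hd i (Finset.mem_univ i)
    simp only [Pi.smul_apply, smul_eq_mul]
    exact_mod_cast this
  ext p
  constructor
  · rintro ⟨t, ht, rfl⟩
    exact ⟨t * (Finset.univ.gcd v : ℤ), by positivity, by rw [hvd, smul_smul]⟩
  · rintro ⟨t, ht, rfl⟩
    refine ⟨t / (Finset.univ.gcd v : ℤ), by positivity, ?_⟩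
    rw [hvd, smul_smul, div_mul_cancel₀ _ hgR.ne']

/-- The primitive direction vector of a rational ray: the integer vector with coprime entries that
spans it. -/
def primitiveVector {n : ℕ} {ρ : Set (Fin n → ℝ)} (h : IsRationalRay ρ) : Fin n → ℤ :=
  h.exists_primitive.choose

theorem gcd_primitiveVector {n : ℕ} {ρ : Set (Fin n → ℝ)} (h : IsRationalRay ρ) :
    Finset.univ.gcd (primitiveVector h) = 1 :=
  h.exists_primitive.choose_spec.1

theorem ray_primitiveVector {n : ℕ} {ρ : Set (Fin n → ℝ)} (h : IsRationalRay ρ) :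
    ρ = ray (primitiveVector h) :=
  h.exists_primitive.choose_spec.2

/-- Any vector with coprime entries that spans the ray is the primitive direction vector. -/
theorem eq_primitiveVector {n : ℕ} {ρ : Set (Fin n → ℝ)} (h : IsRationalRay ρ)
    {d : Fin n → ℤ} (hd : Finset.univ.gcd d = 1) (hρ : ρ = ray d) : d = primitiveVector h := by
  have key : ∀ {d e : Fin n → ℤ}, Finset.univ.gcd d = 1 → Finset.univ.gcd e = 1 →
      (fun i => (d i : ℝ)) ∈ ray e → d = e := by
    intro d e hd he ⟨t, ht, hte⟩
    have hx : ∀ i j, d i * e j = d j * e i := by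
      intro i j
      have hi := congrFun hte i
      have hj := congrFun hte j
      simp only [Pi.smul_apply, smul_eq_mul] at hi hj
      have : (d i : ℝ) * e j = d j * e i := by rw [hi, hj]; ring
      exact_mod_cast this
    have hdv : ∀ {d e : Fin n → ℤ}, Finset.univ.gcd e = 1 →
        (∀ i j, d i * e j = d j * e i) → ∀ i, e i ∣ d i := by
      intro d e he hx i
      have h1 : e i ∣ Finset.univ.gcd fun j => d i * e j :=
        Finset.dvd_gcd fun j _ => ⟨d j, by rw [hx i j, mul_comm]⟩
      rw [Finset.gcd_mul_left, he, mul_one] at h1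
      exact (dvd_normalize_iff).1 h1
    funext i
    have h1 : e i ∣ d i := hdv he hx i
    have h2 : d i ∣ e i := hdv hd (fun i j => by linarith [hx j i]) i
    have hi := congrFun hte i
    simp only [Pi.smul_apply, smul_eq_mul] at hi
    rcases Int.natAbs_eq_natAbs_iff.1 (Nat.dvd_antisymm (Int.natAbs_dvd_natAbs.2 h2)
      (Int.natAbs_dvd_natAbs.2 h1)) with h3 | h3
    · exact h3
    · by_cases h0 : e i = 0
      · simp [h3, h0]
      · exfalso
        have h4 : ((d i : ℤ) : ℝ) = -(e i : ℝ) := by exact_mod_cast congrArg (Int.cast (R := ℝ)) h3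
        have h5 : (e i : ℝ) ≠ 0 := by exact_mod_cast h0
        have h6 : t + 1 = 0 := by
          have : (t + 1) * (e i : ℝ) = 0 := by linarith
          exact (mul_eq_zero.1 this).resolve_right h5
        linarith
  refine key hd (gcd_primitiveVector h) ?_
  rw [← ray_primitiveVector h, hρ]
  exact ⟨1, zero_le_one, by simp⟩

/-- A 1-dimensional tropical fan in `ℝⁿ`: a nonempty finite set of rational rays (the cone `{0}`
being understood), with positive integer weights satisfying the balancing condition. -/
structure Fan (n : ℕ) where
  rays : Finset (Set (Fin n → ℝ))
  rays_nonempty : rays.Nonempty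
  rational : ∀ ρ ∈ rays, IsRationalRay ρ
  weight : rays → ℕ
  weight_pos : ∀ ρ, 0 < weight ρ
  balanced : ∑ ρ : rays, (weight ρ : ℤ) • primitiveVector (rational ρ ρ.2) = 0

namespace Fan

variable {n : ℕ} (X : Fan n)

/-- The primitive direction vector of a ray of the fan. -/
def dir (ρ : X.rays) : Fin n → ℤ := primitiveVector (X.rational ρ ρ.2)

/-- The support of a fan, the union of its rays. -/
def support : Set (Fin n → ℝ) := ⋃ ρ ∈ X.rays, ρ

theorem mem_support {p : Fin n → ℝ} :
    p ∈ X.support ↔ ∃ ρ : X.rays, ∃ t : ℝ, 0 ≤ t ∧ p = t • fun i => (X.dir ρ i : ℝ) := by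
  constructor
  · intro h
    obtain ⟨ρ, hρ, hp⟩ := Set.mem_iUnion₂.1 h
    rw [ray_primitiveVector (X.rational ρ hρ)] at hp
    exact ⟨⟨ρ, hρ⟩, hp⟩
  · rintro ⟨ρ, hp⟩
    refine Set.mem_iUnion₂.2 ⟨ρ, ρ.2, ?_⟩
    rw [ray_primitiveVector (X.rational ρ ρ.2)]
    exact hp

theorem dir_mem_support (ρ : X.rays) : (fun i => (X.dir ρ i : ℝ)) ∈ X.support :=
  X.mem_support.2 ⟨ρ, 1, zero_le_one, by simp⟩

end Fan

/-- Multiplication by a natural number. -/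
def natScale (w : ℕ) : ℤ →+o ℤ where
  toFun x := w * x
  map_zero' := mul_zero _
  map_add' := mul_add _
  monotone' _ _ h := mul_le_mul_of_nonneg_left h (Int.natCast_nonneg w)

/-- The weighted evaluation map with values in all maps `X(1) → ℤ ∪ {-∞}`,
`f ↦ (ρ ↦ w_ρ f(d_ρ))`. -/
def Fan.preEval {n : ℕ} (X : Fan n) : LaurentFcn n →+* (X.rays → MaxPlus ℤ) :=
  RingHom.pi fun ρ => (MaxPlus.map (natScale (X.weight ρ))).comp (intEval (X.dir ρ))

theorem Fan.preEval_mem {n : ℕ} (X : Fan n) (f : LaurentFcn n) : X.preEval f ∈ ZPos X.rays := by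
  obtain ⟨P, rfl⟩ := RingCon.mk'_surjective _ f
  by_cases hP : P = 0
  · subst hP
    rw [map_zero, map_zero]
    exact Or.inr rfl
  · obtain ⟨u, hu⟩ := exists_monomial_le (M := ℤ) hP
    refine Or.inl ?_
    have h1 : ∀ ρ : X.rays,
        MaxPlus.of ((X.weight ρ : ℤ) * ∑ i, u i • X.dir ρ i) ≤
          X.preEval (RingCon.mk' _ P) ρ := fun ρ =>
      WithBot.monotone_map_iff.2 (natScale (X.weight ρ)).monotone' (hu (X.dir ρ))
    have h2 : ∑ ρ : X.rays, (X.weight ρ : ℤ) * ∑ i, u i • X.dir ρ i = 0 := by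
      have hb : ∀ i, ∑ ρ : X.rays, (X.weight ρ : ℤ) * X.dir ρ i = 0 := fun i => by
        simpa [Fan.dir] using congrFun X.balanced i
      simp_rw [Finset.mul_sum]
      rw [Finset.sum_comm]
      refine Finset.sum_eq_zero fun i _ => ?_
      calc ∑ ρ : X.rays, (X.weight ρ : ℤ) * (u i • X.dir ρ i)
          = u i * ∑ ρ : X.rays, (X.weight ρ : ℤ) * X.dir ρ i := by
            rw [Finset.mul_sum]
            exact Finset.sum_congr rfl fun ρ _ => by rw [smul_eq_mul]; ring
        _ = 0 := by rw [hb i, mul_zero]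
    calc MaxPlus.of 0
        = ∏ ρ : X.rays, MaxPlus.of ((X.weight ρ : ℤ) * ∑ i, u i • X.dir ρ i) := by
          rw [MaxPlus.prod_of, h2]
      _ ≤ deg (X.preEval (RingCon.mk' _ P)) := MaxPlus.prod_le_prod_mp _ fun ρ _ => h1 ρ

/-- The weighted evaluation map `φ_X` of a 1-dimensional tropical fan `X`,
`φ_X(f)(ρ) = w_ρ f(d_ρ)`. -/
def Fan.weightedEval {n : ℕ} (X : Fan n) : LaurentFcn n →+* ZPos X.rays :=
  X.preEval.codRestrict _ X.preEval_mem

theorem Fan.weightedEval_apply {n : ℕ} (X : Fan n) (f : LaurentFcn n) (ρ : X.rays) :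
    (X.weightedEval f : X.rays → MaxPlus ℤ) ρ =
      MaxPlus.map (natScale (X.weight ρ)) (intEval (X.dir ρ) f) := rfl

/-- The kernel of the weighted evaluation map is the congruence of the support. -/
theorem Fan.ker_weightedEval {n : ℕ} (X : Fan n) :
    RingCon.ker X.weightedEval = congruenceOf X.support := by
  ext f g
  rw [RingCon.ker_apply, congruenceOf_iff]
  constructor
  · intro h p hp
    obtain ⟨ρ, t, ht, rfl⟩ := X.mem_support.1 hp
    have h1 : X.preEval f ρ = X.preEval g ρ := congrFun (congrArg Subtype.val h) ρ
    have h2 : intEval (X.dir ρ) f = intEval (X.dir ρ) g := by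
      refine MaxPlus.map_injective (natScale (X.weight ρ)) (fun a b hab => ?_) h1
      exact mul_left_cancel₀ (by exact_mod_cast (X.weight_pos ρ).ne') hab
    rw [toFcn_smul _ t ht, toFcn_smul _ t ht, ← castT_intEval, ← castT_intEval, h2]
  · intro h
    refine Subtype.ext (funext fun ρ => ?_)
    rw [Fan.weightedEval_apply, Fan.weightedEval_apply]
    refine congrArg _ (castT_injective ?_)
    rw [castT_intEval, castT_intEval]
    exact h _ (X.dir_mem_support ρ)

/-! ### The category of 1-dimensional tropical fans -/

/-- The linear map `ℝⁿ → ℝᵐ` defined by an integer matrix. -/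
def matrixMap {m n : ℕ} (T : Matrix (Fin m) (Fin n) ℤ) (p : Fin n → ℝ) : Fin m → ℝ :=
  fun j => ∑ i, (T j i : ℝ) * p i

/-- Objects: 1-dimensional tropical fans in `ℝⁿ` for some positive integer `n`. -/
structure TropFan where
  dim : ℕ
  dim_pos : 0 < dim
  fan : Fan dim

/-- Morphisms `X → Y`: maps `|X| → |Y|` that are restrictions of linear maps given by integer
matrices. -/
@[ext]
structure TropFan.Hom (X Y : TropFan) where
  toFun : X.fan.support → Y.fan.support
  exists_matrix : ∃ T : Matrix (Fin Y.dim) (Fin X.dim) ℤ,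
    ∀ p : X.fan.support, (toFun p : Fin Y.dim → ℝ) = matrixMap T p

instance : Category TropFan where
  Hom := TropFan.Hom
  id X :=
    { toFun := id
      exists_matrix := ⟨1, fun p => by
        funext j
        simp [matrixMap, Matrix.one_apply]⟩ }
  comp {X Y Z} f g :=
    { toFun := g.toFun ∘ f.toFun
      exists_matrix := by
        obtain ⟨T, hT⟩ := f.exists_matrix
        obtain ⟨S, hS⟩ := g.exists_matrix
        refine ⟨S * T, fun p => ?_⟩
        rw [Function.comp_apply, hS, hT]
        funext j
        simp only [matrixMap, Matrix.mul_apply, Int.cast_sum, Int.cast_mul, Finset.mul_sum,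
          Finset.sum_mul]
        rw [Finset.sum_comm]
        simp only [mul_assoc] }

/-! ### The category of semiring homomorphisms to `ℤ^A_pos ∪ {-∞}` -/

/-- Objects: semiring homomorphisms from the Boolean Laurent polynomial function semiring in `n`
variables to `ℤ^A_pos ∪ {-∞}`, for some positive integer `n` and some finite set `A`. -/
structure EvalObj where
  dim : ℕ
  dim_pos : 0 < dim
  A : Type
  [fintypeA : Fintype A]
  hom : LaurentFcn dim →+* ZPos A

attribute [instance] EvalObj.fintypeA

/-- Morphisms `φ → ψ`: semiring homomorphisms from the image of `φ` to the image of `ψ`. -/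
@[ext]
structure EvalObj.Hom (φ ψ : EvalObj) where
  toRingHom : φ.hom.rangeS →+* ψ.hom.rangeS

instance : Category EvalObj where
  Hom := EvalObj.Hom
  id _ := ⟨RingHom.id _⟩
  comp f g := ⟨g.toRingHom.comp f.toRingHom⟩

/-! ### The functor -/

/-- The isomorphism of the Boolean function semiring on `X` with the image of `φ_X`. -/
def Fan.quotientEquivRange {n : ℕ} (X : Fan n) :
    (congruenceOf X.support).Quotient ≃+* X.weightedEval.rangeS :=
  (RingCon.congr (RingEquiv.refl _) (by rw [X.ker_weightedEval]; rfl)).trans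
    (RingCon.quotientKerEquivRangeS X.weightedEval)

theorem Fan.quotientEquivRange_mk {n : ℕ} (X : Fan n) (f : LaurentFcn n) :
    X.quotientEquivRange (RingCon.mk' _ f) = X.weightedEval.rangeSRestrict f := rfl

/-- The substitution `y_j ↦ x^{T_j}` of Laurent polynomials, where `T_j` is the `j`-th row
of `T`. -/
def substPoly {m n : ℕ} (T : Matrix (Fin m) (Fin n) ℤ) : LaurentPoly m →+* LaurentPoly n :=
  AddMonoidAlgebra.mapDomainRingHom 𝔹 (Matrix.vecMulLinear T).toAddMonoidHom

theorem polyEval_substPoly {m n : ℕ} (T : Matrix (Fin m) (Fin n) ℤ) (p : Fin n → ℝ)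
    (P : LaurentPoly m) : polyEval p (substPoly T P) = polyEval (matrixMap T p) P := by
  have : (polyEval p).comp (substPoly T) = polyEval (matrixMap T p) := by
    refine poly_hom_ext fun u => ?_
    have h : substPoly T (AddMonoidAlgebra.single u 1)
        = AddMonoidAlgebra.single (Matrix.vecMul u T) 1 := by
      simp [substPoly]
    rw [RingHom.comp_apply, h, polyEval_single, polyEval_single]
    congr 1
    simp only [Matrix.vecMul, dotProduct, matrixMap, zsmul_eq_mul, Int.cast_sum, Int.cast_mul,
      Finset.sum_mul, Finset.mul_sum]
    rw [Finset.sum_comm]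
    simp only [mul_assoc]
  exact congrArg (fun f => f P) this

/-- The pullback of Boolean Laurent polynomial functions along the linear map given by `T`. -/
def substFcn {m n : ℕ} (T : Matrix (Fin m) (Fin n) ℤ) : LaurentFcn m →+* LaurentFcn n :=
  RingCon.lift _ ((RingCon.mk' _).comp (substPoly T)) fun P Q h => by
    have h' : polyFunction m P = polyFunction m Q := h
    refine (RingCon.eq _).2 ?_
    rw [RingCon.ker_apply]
    funext p
    exact (polyEval_substPoly T p P).trans
      ((congrFun h' (matrixMap T p)).trans (polyEval_substPoly T p Q).symm)

theorem toFcn_substFcn {m n : ℕ} (T : Matrix (Fin m) (Fin n) ℤ) (f : LaurentFcn m)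
    (p : Fin n → ℝ) : toFcn n (substFcn T f) p = toFcn m f (matrixMap T p) := by
  obtain ⟨P, rfl⟩ := RingCon.mk'_surjective _ f
  exact polyEval_substPoly T p P

/-- The homomorphism `μ^*`, `f ↦ f ∘ μ`, from the Boolean function semiring on `Y` to that
on `X`, for a morphism `μ : X ⟶ Y`; see `TropFan.Hom.pullback_mk`. -/
def TropFan.Hom.pullback {X Y : TropFan} (μ : TropFan.Hom X Y) :
    (congruenceOf Y.fan.support).Quotient →+* (congruenceOf X.fan.support).Quotient :=
  RingCon.lift _ ((RingCon.mk' _).comp (substFcn μ.exists_matrix.choose)) fun f g h => by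
    refine (RingCon.eq _).2 (congruenceOf_iff.2 fun p hp => ?_)
    rw [toFcn_substFcn, toFcn_substFcn, ← μ.exists_matrix.choose_spec ⟨p, hp⟩]
    exact congruenceOf_iff.1 h _ (μ.toFun ⟨p, hp⟩).2

/-- `μ^* [f] = [g]` if and only if `g` restricts to `f ∘ μ` on the support of `X`. -/
theorem TropFan.Hom.pullback_mk {X Y : TropFan} (μ : TropFan.Hom X Y) (f : LaurentFcn Y.dim)
    (g : LaurentFcn X.dim) :
    μ.pullback (RingCon.mk' _ f) = RingCon.mk' _ g ↔
      ∀ p : X.fan.support, toFcn _ f (μ.toFun p) = toFcn _ g p := by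
  have h : μ.pullback (RingCon.mk' _ f) = RingCon.mk' _ (substFcn μ.exists_matrix.choose f) := rfl
  rw [h]
  refine (RingCon.eq _).trans (congruenceOf_iff.trans ?_)
  rw [Subtype.forall]
  refine forall₂_congr fun p hp => ?_
  rw [toFcn_substFcn, ← μ.exists_matrix.choose_spec ⟨p, hp⟩]

/-- The homomorphism `Im φ_Y → Im φ_X` induced by a morphism `μ : X ⟶ Y` of fans: the composite
of `Im φ_Y ≅ 𝔹[y^±]_fcn / 𝐄(Y)`, the pullback `μ^*`, and `𝔹[x^±]_fcn / 𝐄(X) ≅ Im φ_X`. -/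
def TropFan.Hom.induced {X Y : TropFan} (μ : TropFan.Hom X Y) :
    Y.fan.weightedEval.rangeS →+* X.fan.weightedEval.rangeS :=
  (X.fan.quotientEquivRange.toRingHom.comp μ.pullback).comp Y.fan.quotientEquivRange.symm.toRingHom

theorem TropFan.Hom.induced_apply {X Y : TropFan} (μ : TropFan.Hom X Y) (f : LaurentFcn Y.dim)
    (g : LaurentFcn X.dim) (h : ∀ p : X.fan.support, toFcn _ f (μ.toFun p) = toFcn _ g p) :
    μ.induced (Y.fan.weightedEval.rangeSRestrict f) = X.fan.weightedEval.rangeSRestrict g := by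
  have h1 : Y.fan.quotientEquivRange.symm (Y.fan.weightedEval.rangeSRestrict f)
      = RingCon.mk' _ f := by
    rw [← Fan.quotientEquivRange_mk, RingEquiv.symm_apply_apply]
  have h2 : μ.induced (Y.fan.weightedEval.rangeSRestrict f)
      = X.fan.quotientEquivRange
        (μ.pullback (Y.fan.quotientEquivRange.symm (Y.fan.weightedEval.rangeSRestrict f))) := rfl
  rw [h2, h1, (μ.pullback_mk f g).2 h, Fan.quotientEquivRange_mk]

theorem TropFan.Hom.exists_pullback {X Y : TropFan} (μ : TropFan.Hom X Y)
    (f : LaurentFcn Y.dim) :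
    ∃ g : LaurentFcn X.dim, ∀ p : X.fan.support, toFcn _ f (μ.toFun p) = toFcn _ g p :=
  ⟨substFcn μ.exists_matrix.choose f, (μ.pullback_mk f _).1 rfl⟩

/-- The contravariant functor `Φ`, which sends a 1-dimensional tropical fan `X` to its weighted
evaluation map `φ_X` and a morphism `μ : X ⟶ Y` to the induced homomorphism `Im φ_Y → Im φ_X`. -/
def Phi : TropFanᵒᵖ ⥤ EvalObj where
  obj X :=
    { dim := X.unop.dim
      dim_pos := X.unop.dim_pos
      A := X.unop.fan.rays
      hom := X.unop.fan.weightedEval }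
  map μ := ⟨TropFan.Hom.induced μ.unop⟩
  map_id X := by
    refine EvalObj.Hom.ext (RingHom.ext fun a => ?_)
    obtain ⟨f, rfl⟩ := RingHom.rangeSRestrict_surjective _ a
    exact TropFan.Hom.induced_apply _ f f fun _ => rfl
  map_comp {X Y Z} μ ν := by
    refine EvalObj.Hom.ext (RingHom.ext fun a => ?_)
    obtain ⟨f, rfl⟩ := RingHom.rangeSRestrict_surjective _ a
    obtain ⟨g, hg⟩ := TropFan.Hom.exists_pullback μ.unop f
    obtain ⟨h, hh⟩ := TropFan.Hom.exists_pullback ν.unop g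
    refine (TropFan.Hom.induced_apply _ f h fun p => ?_).trans ?_
    · exact (hg _).trans (hh p)
    · refine (TropFan.Hom.induced_apply ν.unop g h hh).symm.trans ?_
      exact congrArg _ (TropFan.Hom.induced_apply μ.unop f g hg).symm

end TropicalFans

end

/-! The units of `Im φ_X` are exactly the images of the monomials, and this forces every
homomorphism to come from an integer matrix. If `f g = 1` in the image, choose monomials `x^u` of
`f` and `x^v` of `g`. On each ray `w_ρ (u + v)·d_ρ ≤ 0`, while by balancing these numbers sum to
zero. So all of them vanish and `f` agrees with `x^u` on the fan
(`Fan.exists_monomialFcn_of_isUnit`).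

A homomorphism `F : Im φ_Y → Im φ_X` preserves units, so it sends each coordinate `y_j` to a
monomial `x^{T_j}`. Coordinates determine homomorphisms out of `LaurentFcn`, hence `F` is the
substitution given by the matrix `T` (`Fan.exists_matrix_of_ringHom`).

It remains to see that `T` maps `|X|` into `|Y|`. Since `F` is well defined, functions that agree on
`|Y|` also agree at `T d_ρ` for every ray `ρ` of `X`. A point off `|Y|` would be detected by such a
pair: separate it from each ray by an integer linear form `u_ρ`, and compare `⨁ x^{u_ρ}` with `⨁
x^{u_ρ} + 1` (`Fan.mem_support_of_congruenceOf`). This gives fullness. Faithfulness holds because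
the pullbacks of the coordinate functions recover the map. -/

namespace TropicalFans

/-! ### Monomials and the units of the image of `φ_X` -/

/-- The class of the monomial `x^u` in the Boolean Laurent polynomial function semiring. -/
noncomputable def monomialFcn {n : ℕ} (u : Fin n → ℤ) : LaurentFcn n :=
  RingCon.mk' _ (AddMonoidAlgebra.single u 1)

theorem toFcn_monomialFcn {n : ℕ} (u : Fin n → ℤ) (p : Fin n → ℝ) :
    toFcn n (monomialFcn u) p = MaxPlus.of (∑ i, u i • p i) :=
  polyEval_single p u

theorem intEval_monomialFcn {n : ℕ} (u d : Fin n → ℤ) :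
    intEval d (monomialFcn u) = MaxPlus.of (∑ i, u i • d i) :=
  polyEval_single d u

theorem MaxPlus.of_injective {M : Type*} : Function.Injective (MaxPlus.of (M := M)) :=
  WithBot.coe_injective

theorem MaxPlus.of_le_of {M : Type*} [LinearOrder M] {x y : M} :
    MaxPlus.of x ≤ MaxPlus.of y ↔ x ≤ y :=
  WithBot.coe_le_coe

theorem MaxPlus.zero_ne_of {M : Type*} [LinearOrder M] (x : M) : (0 : MaxPlus M) ≠ MaxPlus.of x :=
  WithBot.bot_ne_coe

theorem MaxPlus.eq_zero_or_eq_of {M : Type*} (x : MaxPlus M) :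
    x = 0 ∨ ∃ y, x = MaxPlus.of y := by
  induction x using WithBot.recBotCoe with
  | bot => exact Or.inl rfl
  | coe y => exact Or.inr ⟨y, rfl⟩

/-- The weighted directions of a fan sum to zero against every integer linear form. -/
theorem Fan.sum_weight_mul_dot {n : ℕ} (X : Fan n) (u : Fin n → ℤ) :
    ∑ ρ : X.rays, (X.weight ρ : ℤ) * ∑ i, u i • X.dir ρ i = 0 := by
  have hb : ∀ i, ∑ ρ : X.rays, (X.weight ρ : ℤ) * X.dir ρ i = 0 := fun i => by
    simpa [Fan.dir] using congrFun X.balanced i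
  simp_rw [Finset.mul_sum]
  rw [Finset.sum_comm]
  refine Finset.sum_eq_zero fun i _ => ?_
  calc ∑ ρ : X.rays, (X.weight ρ : ℤ) * (u i • X.dir ρ i)
      = u i * ∑ ρ : X.rays, (X.weight ρ : ℤ) * X.dir ρ i := by
        rw [Finset.mul_sum]
        exact Finset.sum_congr rfl fun ρ _ => by rw [smul_eq_mul]; ring
    _ = 0 := by rw [hb i, mul_zero]

theorem Fan.weightedEval_monomialFcn {n : ℕ} (X : Fan n) (u : Fin n → ℤ) (ρ : X.rays) :
    (X.weightedEval (monomialFcn u) : X.rays → MaxPlus ℤ) ρ =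
      MaxPlus.of ((X.weight ρ : ℤ) * ∑ i, u i • X.dir ρ i) := by
  rw [Fan.weightedEval_apply, intEval_monomialFcn]
  rfl

/-- A nonzero function is a maximum of monomials, so any monomial of a representing polynomial
bounds it from below. The point is that one exponent serves all rays at once, so that balancing
applies to it. -/
theorem Fan.exists_monomialFcn_le {n : ℕ} (X : Fan n) {f : LaurentFcn n} (hf : f ≠ 0) :
    ∃ u : Fin n → ℤ, ∀ ρ : X.rays, MaxPlus.of ((X.weight ρ : ℤ) * ∑ i, u i • X.dir ρ i) ≤
      (X.weightedEval f : X.rays → MaxPlus ℤ) ρ := by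
  obtain ⟨P, rfl⟩ := RingCon.mk'_surjective _ f
  have hP : P ≠ 0 := by
    rintro rfl
    exact hf (map_zero _)
  obtain ⟨u, hu⟩ := exists_monomial_le (M := ℤ) hP
  exact ⟨u, fun ρ => WithBot.monotone_map_iff.2 (natScale (X.weight ρ)).monotone' (hu (X.dir ρ))⟩

/-- The units of the image of a weighted evaluation map are the images of the monomials. -/
theorem Fan.exists_monomialFcn_of_isUnit {n : ℕ} (X : Fan n) {a : X.weightedEval.rangeS}
    (ha : IsUnit a) : ∃ u, a = X.weightedEval.rangeSRestrict (monomialFcn u) := by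
  obtain ⟨b, hab⟩ := ha.exists_right_inv
  obtain ⟨f, rfl⟩ := RingHom.rangeSRestrict_surjective _ a
  obtain ⟨g, rfl⟩ := RingHom.rangeSRestrict_surjective _ b
  have hval : ∀ ρ, (X.weightedEval f : X.rays → MaxPlus ℤ) ρ *
      (X.weightedEval g : X.rays → MaxPlus ℤ) ρ = MaxPlus.of 0 := fun ρ =>
    congrFun (congrArg Subtype.val (congrArg Subtype.val hab)) ρ
  -- Evaluating at some ray shows that neither factor is zero, because `-∞` absorbs products and
  -- differs from `MaxPlus.of 0`, the unit.
  obtain ⟨ρ₀, hρ₀⟩ := X.rays_nonempty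
  have hf : f ≠ 0 := by
    rintro rfl
    have := hval ⟨ρ₀, hρ₀⟩
    rw [map_zero] at this
    exact MaxPlus.zero_ne_of _ ((zero_mul _).symm.trans this)
  have hg : g ≠ 0 := by
    rintro rfl
    have := hval ⟨ρ₀, hρ₀⟩
    rw [map_zero] at this
    exact MaxPlus.zero_ne_of _ ((mul_zero _).symm.trans this)
  obtain ⟨u, hu⟩ := X.exists_monomialFcn_le hf
  obtain ⟨v, hv⟩ := X.exists_monomialFcn_le hg
  have hle : ∀ ρ ∈ (Finset.univ : Finset X.rays), (X.weight ρ : ℤ) * ∑ i, u i • X.dir ρ i +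
      (X.weight ρ : ℤ) * ∑ i, v i • X.dir ρ i ≤ 0 := fun ρ _ => by
    have h := MaxPlus.mul_le_mul_mp (hu ρ) (hv ρ)
    rwa [hval, ← MaxPlus.of_add, MaxPlus.of_le_of] at h
  -- Balancing makes the sum of these nonpositive terms zero, so each term is zero.
  have hsum := (Finset.sum_eq_zero_iff_of_nonpos hle).1 (by
    rw [Finset.sum_add_distrib, X.sum_weight_mul_dot, X.sum_weight_mul_dot, add_zero])
  refine ⟨u, Subtype.ext (Subtype.ext (funext fun ρ => ?_))⟩
  refine Eq.trans ?_ (X.weightedEval_monomialFcn u ρ).symm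
  change (X.weightedEval f : X.rays → MaxPlus ℤ) ρ = _
  have h1 := hu ρ
  have h2 := hv ρ
  have h3 := hval ρ
  have h4 := hsum ρ (Finset.mem_univ ρ)
  rcases MaxPlus.eq_zero_or_eq_of ((X.weightedEval f : X.rays → MaxPlus ℤ) ρ) with hx | ⟨x, hx⟩
  · rw [hx, zero_mul] at h3
    exact absurd h3 (MaxPlus.zero_ne_of _)
  rcases MaxPlus.eq_zero_or_eq_of ((X.weightedEval g : X.rays → MaxPlus ℤ) ρ) with hy | ⟨y, hy⟩
  · rw [hy, mul_zero] at h3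
    exact absurd h3 (MaxPlus.zero_ne_of _)
  rw [hx, MaxPlus.of_le_of] at h1
  rw [hy, MaxPlus.of_le_of] at h2
  rw [hx, hy, ← MaxPlus.of_add] at h3
  have h5 := MaxPlus.of_injective h3
  rw [hx]
  -- The lower bounds for `x` and `y` add up to zero, and so do `x` and `y`; both bounds are
  -- therefore equalities.
  exact congrArg _ (by linarith)

theorem isUnit_monomialFcn {n : ℕ} (u : Fin n → ℤ) : IsUnit (monomialFcn u) := by
  refine IsUnit.of_mul_eq_one (monomialFcn (-u)) ?_
  rw [monomialFcn, monomialFcn, ← map_mul, AddMonoidAlgebra.single_mul_single, add_neg_cancel,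
    one_mul, ← AddMonoidAlgebra.one_def, map_one]

/-! ### Separating integer points from the support -/

/-- An integer vector off the ray of `d` is separated from it by an integer linear form. -/
theorem exists_dot_nonneg_dot_neg {n : ℕ} {d q : Fin n → ℤ}
    (h : (fun i => (q i : ℝ)) ∉ ray d) : ∃ u : Fin n → ℤ, 0 ≤ u ⬝ᵥ d ∧ u ⬝ᵥ q < 0 := by
  have hq : q ≠ 0 := by
    rintro rfl
    exact h ⟨0, le_rfl, by ext; simp⟩
  have nonneg : ∀ v : Fin n → ℤ, 0 ≤ v ⬝ᵥ v := fun v =>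
    Finset.sum_nonneg fun i _ => mul_self_nonneg (v i)
  have hqq : 0 < q ⬝ᵥ q := lt_of_le_of_ne (nonneg q) fun h0 => hq (dotProduct_self_eq_zero.1 h0.symm)
  -- If `d` and `q` form no acute angle, `-q` separates. Otherwise take the negative of the
  -- component of `q` orthogonal to `d`, scaled by `d ⬝ᵥ d` to be integral; it vanishes on `d`.
  rcases le_or_gt (d ⬝ᵥ q) 0 with hdq | hdq
  · exact ⟨-q, by rw [neg_dotProduct, dotProduct_comm]; linarith,
      by rw [neg_dotProduct]; linarith⟩
  · have hdd : 0 < d ⬝ᵥ d := lt_of_le_of_ne (nonneg d) fun h0 => by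
      rw [dotProduct_self_eq_zero.1 h0.symm, zero_dotProduct] at hdq
      exact hdq.false
    refine ⟨(d ⬝ᵥ q) • d - (d ⬝ᵥ d) • q, ?_, ?_⟩
    · rw [sub_dotProduct, smul_dotProduct, smul_dotProduct, dotProduct_comm q d]
      simp only [smul_eq_mul]
      linarith
    · rw [sub_dotProduct, smul_dotProduct, smul_dotProduct, smul_eq_mul, smul_eq_mul]
      -- Strict Cauchy–Schwarz: failure of the inequality forces the orthogonal component of `q` to
      -- have square length at most zero, so `q` is parallel to `d`.
      by_contra! hcon
      have key : ((d ⬝ᵥ d) • q - (d ⬝ᵥ q) • d) ⬝ᵥ ((d ⬝ᵥ d) • q - (d ⬝ᵥ q) • d) =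
          (d ⬝ᵥ d) * ((d ⬝ᵥ d) * (q ⬝ᵥ q) - (d ⬝ᵥ q) * (d ⬝ᵥ q)) := by
        simp only [sub_dotProduct, dotProduct_sub, smul_dotProduct, dotProduct_smul, smul_eq_mul,
          dotProduct_comm q d]
        ring
      have hz : (d ⬝ᵥ d) • q - (d ⬝ᵥ q) • d = 0 := by
        refine dotProduct_self_eq_zero.1 (le_antisymm ?_ (nonneg _))
        rw [key]
        exact mul_nonpos_of_nonneg_of_nonpos hdd.le (by linarith)
      have hddR : (0 : ℝ) < (d ⬝ᵥ d : ℤ) := by exact_mod_cast hdd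
      have hdqR : (0 : ℝ) < (d ⬝ᵥ q : ℤ) := by exact_mod_cast hdq
      -- The factor is positive because `d ⬝ᵥ q > 0`, so `q` lies on the ray itself and not on its
      -- opposite.
      refine h ⟨(d ⬝ᵥ q : ℤ) / (d ⬝ᵥ d : ℤ), by positivity, funext fun i => ?_⟩
      have hi : (d ⬝ᵥ d) * q i = (d ⬝ᵥ q) * d i := sub_eq_zero.1 (congrFun hz i)
      have hiR : ((d ⬝ᵥ d : ℤ) : ℝ) * q i = (d ⬝ᵥ q : ℤ) * d i := by exact_mod_cast hi
      rw [Pi.smul_apply, smul_eq_mul, div_mul_eq_mul_div, eq_div_iff hddR.ne', ← hiR, mul_comm]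

theorem MaxPlus.le_sum {M ι : Type*} [AddCommMonoid M] [LinearOrder M] [IsOrderedAddMonoid M]
    (s : Finset ι) (f : ι → MaxPlus M) {i : ι} (hi : i ∈ s) : f i ≤ ∑ j ∈ s, f j := by
  classical
  rw [← Finset.add_sum_erase s f hi, MaxPlus.add_eq_max]
  exact le_max_left _ _

/-- A finite sum is a maximum, and the empty sum is `-∞`, so the strict bound needs no nonemptiness.
-/
theorem MaxPlus.sum_lt_of {M ι : Type*} [AddCommMonoid M] [LinearOrder M] [IsOrderedAddMonoid M]
    (s : Finset ι) (f : ι → MaxPlus M) {c : M} (h : ∀ i ∈ s, f i < MaxPlus.of c) :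
    ∑ i ∈ s, f i < MaxPlus.of c := by
  classical
  induction s using Finset.induction_on with
  | empty => exact WithBot.bot_lt_coe c
  | insert a s ha ih =>
    rw [Finset.sum_insert ha, MaxPlus.add_eq_max]
    exact max_lt (h a (Finset.mem_insert_self a s))
      (ih fun i hi => h i (Finset.mem_insert_of_mem hi))

/-- The integer points of the variety of the congruence of the support of a fan lie on the
support. -/
theorem Fan.mem_support_of_congruenceOf {n : ℕ} (X : Fan n) {q : Fin n → ℤ}
    (h : ∀ f g, congruenceOf X.support f g → intEval q f = intEval q g) :
    (fun i => (q i : ℝ)) ∈ X.support := by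
  by_contra hq
  have hsep : ∀ ρ : X.rays, ∃ u : Fin n → ℤ, 0 ≤ u ⬝ᵥ X.dir ρ ∧ u ⬝ᵥ q < 0 := fun ρ =>
    exists_dot_nonneg_dot_neg fun ⟨t, ht, hqt⟩ => hq (X.mem_support.2 ⟨ρ, t, ht, hqt⟩)
  choose u hu hu' using hsep
  have hval : ∀ d, intEval d (∑ ρ, monomialFcn (u ρ)) = ∑ ρ, MaxPlus.of (u ρ ⬝ᵥ d) := fun d => by
    rw [map_sum]
    exact Finset.sum_congr rfl fun ρ _ => intEval_monomialFcn _ _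
  -- On each ray some form `u ρ` is nonnegative, so adding the constant `1` (the value `0`) changes
  -- nothing on the support. At `q` all forms are negative and the two functions differ.
  have h1 : congruenceOf X.support (∑ ρ, monomialFcn (u ρ) + 1) (∑ ρ, monomialFcn (u ρ)) := by
    rw [← X.ker_weightedEval, RingCon.ker_apply]
    refine Subtype.ext (funext fun ρ => ?_)
    rw [Fan.weightedEval_apply, Fan.weightedEval_apply, map_add, map_one, hval,
      MaxPlus.add_eq_max, ← MaxPlus.of_zero, max_eq_left]
    exact (MaxPlus.of_le_of.2 (hu ρ)).trans
      (MaxPlus.le_sum Finset.univ (fun σ => MaxPlus.of (u σ ⬝ᵥ X.dir ρ)) (Finset.mem_univ ρ))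
  have h2 := h _ _ h1
  rw [map_add, map_one, hval, MaxPlus.add_eq_max, ← MaxPlus.of_zero] at h2
  have h3 : ∑ ρ, MaxPlus.of (u ρ ⬝ᵥ q) < MaxPlus.of 0 :=
    MaxPlus.sum_lt_of _ _ fun ρ _ => WithBot.coe_lt_coe.2 (hu' ρ)
  rw [max_eq_right h3.le] at h2
  exact h3.ne' h2

/-! ### Homomorphisms as matrix substitutions -/

theorem substFcn_monomialFcn {m n : ℕ} (T : Matrix (Fin m) (Fin n) ℤ) (u : Fin m → ℤ) :
    substFcn T (monomialFcn u) = monomialFcn (Matrix.vecMul u T) := by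
  have h : substPoly T (AddMonoidAlgebra.single u 1)
      = AddMonoidAlgebra.single (Matrix.vecMul u T) 1 := by
    simp [substPoly]
  exact congrArg (RingCon.mk' _) h

/-- A semiring homomorphism out of the Boolean Laurent polynomial function semiring is determined
by its values on the coordinates. -/
theorem laurentFcn_hom_ext {n : ℕ} {R : Type*} [CommSemiring R] {f g : LaurentFcn n →+* R}
    (h : ∀ j, f (monomialFcn (Pi.single j 1)) = g (monomialFcn (Pi.single j 1))) : f = g := by
  -- Exponents turn into products, so `u ↦ k (x^u)` is a homomorphism from `ℤⁿ` to the
  -- multiplicative monoid of `R`. It is written additively so that the values on the standard basis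
  -- determine it.
  have key : ∀ k : LaurentFcn n →+* R, ∃ φ : (Fin n → ℤ) →+ Additive R,
      ∀ u, (φ u).toMul = k (monomialFcn u) := fun k =>
    ⟨MonoidHom.toAdditiveRight
      ((k.comp (RingCon.mk' _) : LaurentPoly n →* R).comp (AddMonoidAlgebra.of 𝔹 (Fin n → ℤ))),
      fun u => rfl⟩
  obtain ⟨φ, hφ⟩ := key f
  obtain ⟨ψ, hψ⟩ := key g
  have hφψ : φ = ψ := AddMonoidHom.functions_ext' _ _ _ fun j => AddMonoidHom.ext_int (by
    refine Additive.toMul.injective ?_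
    exact (hφ _).trans ((h j).trans (hψ _).symm))
  have hfg : f.comp (RingCon.mk' _) = g.comp (RingCon.mk' _) := poly_hom_ext fun u => by
    exact (hφ u).symm.trans ((congrArg (fun χ => (χ u).toMul) hφψ).trans (hψ u))
  refine RingHom.ext fun x => ?_
  obtain ⟨P, rfl⟩ := RingCon.mk'_surjective _ x
  exact congrArg (fun χ => χ P) hfg

theorem matrixMap_smul {m n : ℕ} (T : Matrix (Fin m) (Fin n) ℤ) (t : ℝ) (p : Fin n → ℝ) :
    matrixMap T (t • p) = t • matrixMap T p := by
  funext j
  simp only [matrixMap, Pi.smul_apply, smul_eq_mul, Finset.mul_sum]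
  exact Finset.sum_congr rfl fun i _ => by ring

theorem matrixMap_intCast {m n : ℕ} (T : Matrix (Fin m) (Fin n) ℤ) (d : Fin n → ℤ) :
    matrixMap T (fun i => (d i : ℝ)) = fun j => ((T.mulVec d j : ℤ) : ℝ) := by
  funext j
  simp [matrixMap, Matrix.mulVec, dotProduct]

theorem Fan.smul_mem_support {n : ℕ} (X : Fan n) {t : ℝ} (ht : 0 ≤ t) {p : Fin n → ℝ}
    (hp : p ∈ X.support) : t • p ∈ X.support := by
  obtain ⟨ρ, s, hs, rfl⟩ := X.mem_support.1 hp
  exact X.mem_support.2 ⟨ρ, t * s, mul_nonneg ht hs, smul_smul _ _ _⟩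

/-- A semiring homomorphism between the images of weighted evaluation maps is the substitution
given by an integer matrix. -/
theorem Fan.exists_matrix_of_ringHom {m n : ℕ} (Y : Fan m) (X : Fan n)
    (F : Y.weightedEval.rangeS →+* X.weightedEval.rangeS) :
    ∃ T : Matrix (Fin m) (Fin n) ℤ, ∀ f, F (Y.weightedEval.rangeSRestrict f) =
      X.weightedEval.rangeSRestrict (substFcn T f) := by
  have hT : ∀ j : Fin m, ∃ v : Fin n → ℤ,
      F (Y.weightedEval.rangeSRestrict (monomialFcn (Pi.single j 1))) =
        X.weightedEval.rangeSRestrict (monomialFcn v) := fun j =>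
    X.exists_monomialFcn_of_isUnit
      (((isUnit_monomialFcn (Pi.single j 1)).map Y.weightedEval.rangeSRestrict).map F)
  -- The rows are unique only up to linear forms vanishing on the support of `X`; any choice will
  -- do.
  choose T hT using hT
  have h : F.comp Y.weightedEval.rangeSRestrict =
      X.weightedEval.rangeSRestrict.comp (substFcn (Matrix.of T)) :=
    laurentFcn_hom_ext fun j => by
      rw [RingHom.comp_apply, RingHom.comp_apply, substFcn_monomialFcn, hT,
        Matrix.single_one_vecMul]
      rfl
  exact ⟨Matrix.of T, fun f => congrArg (fun χ => χ f) h⟩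

/-! ### The induced map of supports, fullness and faithfulness -/

/-- A matrix whose substitution descends to the images of the weighted evaluation maps maps the
support of the one fan into the support of the other. -/
theorem Fan.matrixMap_mem_support {m n : ℕ} (Y : Fan m) (X : Fan n)
    {F : Y.weightedEval.rangeS →+* X.weightedEval.rangeS} {T : Matrix (Fin m) (Fin n) ℤ}
    (hT : ∀ f, F (Y.weightedEval.rangeSRestrict f) = X.weightedEval.rangeSRestrict (substFcn T f))
    {p : Fin n → ℝ} (hp : p ∈ X.support) : matrixMap T p ∈ Y.support := by
  obtain ⟨ρ, t, ht, rfl⟩ := X.mem_support.1 hp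
  -- By homogeneity it is enough to treat the primitive direction, whose image is an integer vector;
  -- this is why separation of integer points suffices.
  rw [matrixMap_smul]
  refine Y.smul_mem_support ht ?_
  rw [matrixMap_intCast]
  refine Y.mem_support_of_congruenceOf fun f g hfg => castT_injective ?_
  rw [← Y.ker_weightedEval, RingCon.ker_apply] at hfg
  have h1 : X.weightedEval.rangeSRestrict (substFcn T f) =
      X.weightedEval.rangeSRestrict (substFcn T g) := by
    rw [← hT, ← hT]
    exact congrArg F (Subtype.ext hfg)
  have h2 : congruenceOf X.support (substFcn T f) (substFcn T g) := by
    rw [← X.ker_weightedEval, RingCon.ker_apply]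
    exact congrArg Subtype.val h1
  have h3 := congruenceOf_iff.1 h2 _ (X.dir_mem_support ρ)
  rwa [toFcn_substFcn, toFcn_substFcn, matrixMap_intCast, ← castT_intEval, ← castT_intEval] at h3

/-- Fullness: the matrix of exponents restricts to a map of supports, and pulling back along it is
the substitution that describes `F`. -/
theorem TropFan.Hom.exists_induced_eq {X Y : TropFan}
    (F : Y.fan.weightedEval.rangeS →+* X.fan.weightedEval.rangeS) :
    ∃ μ : TropFan.Hom X Y, μ.induced = F := by
  obtain ⟨T, hT⟩ := Fan.exists_matrix_of_ringHom Y.fan X.fan F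
  refine ⟨⟨fun p => ⟨matrixMap T p, Fan.matrixMap_mem_support Y.fan X.fan hT p.2⟩,
    T, fun _ => rfl⟩, RingHom.ext fun a => ?_⟩
  obtain ⟨f, rfl⟩ := RingHom.rangeSRestrict_surjective _ a
  rw [hT]
  exact TropFan.Hom.induced_apply _ f _ fun p => (toFcn_substFcn T f p).symm

/-- Faithfulness: pulling back the coordinate function `y_j` and evaluating at `p` gives the `j`-th
coordinate of the image of `p`, so the induced homomorphism determines the map on the support,
though not the matrix. -/
theorem TropFan.Hom.induced_injective {X Y : TropFan} :
    Function.Injective (TropFan.Hom.induced (X := X) (Y := Y)) := by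
  intro μ ν h
  refine TropFan.Hom.ext (funext fun p => Subtype.ext (funext fun j => ?_))
  obtain ⟨f, hf⟩ := μ.exists_pullback (monomialFcn (Pi.single j 1))
  obtain ⟨g, hg⟩ := ν.exists_pullback (monomialFcn (Pi.single j 1))
  have h1 : X.fan.weightedEval.rangeSRestrict f = X.fan.weightedEval.rangeSRestrict g := by
    rw [← μ.induced_apply _ f hf, ← ν.induced_apply _ g hg, h]
  have h2 : congruenceOf X.fan.support f g := by
    rw [← X.fan.ker_weightedEval, RingCon.ker_apply]
    exact congrArg Subtype.val h1
  have h3 := (hf p).trans ((congruenceOf_iff.1 h2 p p.2).trans (hg p).symm)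
  rw [toFcn_monomialFcn, toFcn_monomialFcn] at h3
  simpa [Pi.single_apply] using MaxPlus.of_injective h3

end TropicalFans

theorem mainTheorem3 : TropicalFans.Phi.Full ∧ TropicalFans.Phi.Faithful := by
  refine ⟨⟨fun {X Y} F => ?_⟩, ⟨fun {X Y} μ ν h => ?_⟩⟩
  · obtain ⟨μ, hμ⟩ := TropicalFans.TropFan.Hom.exists_induced_eq F.toRingHom
    exact ⟨Quiver.Hom.op μ, TropicalFans.EvalObj.Hom.ext hμ⟩
  · exact Quiver.Hom.unop_inj (TropicalFans.TropFan.Hom.induced_injective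
      (congrArg TropicalFans.EvalObj.Hom.toRingHom h))
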